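/- Let $(X,\mathcal F,\mu)$ be a $\sigma$-finite measure space and let $\Phi:\mathbb R\to[0,\infty]$ be a Young function, i.e. $\Phi$ is convex and even, $\Phi(0)=0$, $\lim_{x\to\infty}\Phi(x)=\infty$, and $\Phi(x)<\infty$ for some $x>0$. Put $\Phi^{-1}(y)=\inf\{x\ge 0:\Phi(x)>y\}$ for $y\in[0,\infty]$ (with $\inf\emptyset=\infty$, so $\Phi^{-1}(\infty)=\infty$), let $L^\Phi(\mu)$ be the space of a.e. classes of real measurable $f$ with $\int\Phi(kf)\,d\mu<\infty$ for some $k>0$, with the norm $N_\Phi(f)=\inf\{k>0:\int\Phi(f/k)\,d\mu\le1\}$. We write $\Phi\in\Delta_2$ if there are $K>0$, $x_0>0$ with $\Phi(2x)\le K\Phi(x)<\infty$ for all $x\ge x_0$. Let $\varphi:X\to X$ be measurable and non-singular ($\mu(F)=0\Rightarrow\mu(\varphi^{-1}(F))=0$) such that the composition operator $C_\varphi f=f\circ\varphi$ is a well-defined continuous operator on $L^\Phi(\mu)$ (this holds for instance if $\mu(\varphi^{-1}(F))\le c\,\mu(F)$ for all $F\in\mathcal F$ and some constant $c>0$). In what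 follows $1/0=\infty$, $1/\infty=0$, and $\mu(\varphi^n(F))$ denotes the outer measure if $\varphi^n(F)$ is not measurable. A map $T$ of a metric space $(M,d)$ is Li-Yorke chaotic if there is an uncountable $S\subseteq M$ such that for all distinct $x,y\in S$ we have $\liminf_n d(T^nx,T^ny)=0$ and $\limsup_n d(T^nx,T^ny)>0$; a vector $x$ is semi-irregular for $T$ if $\liminf_n\|T^nx\|=0$ and $\limsup_n\|T^nx\|>0$. Consider the following conditions. 1. $C_\varphi:L^\Phi(\mu)\to L^\Phi(\mu)$ is Li-Yorke chaotic. 2. There is a nonzero $f\in L^\Phi(\mu)$ with $\liminf_n N_\Phi(C_\varphi^nf)=0$. 3. There is $F\in\mathcal F$ with $0<\mu(F)<\infty$ and $\limsup_n\Phi^{-1}\big(1/\mu(\varphi^{-n}(F))\big)=\infty$. 4. There is $F\in\mathcal F$ with $0<\mu(F)<\infty$ and $\limsup_n\Phi^{-1}\big(1/\mu(\varphi^{n}(F))\big)=\infty$. 5. There is $F\in\mathcal F$ with $0<\mu(F)<\infty$, $\limsup_n\Phi^{-1}\big(1/\mu(\varphi^{-n}(F))\big)=\infty$ and $\limsup_n\Phi^{-1}\big(1/\mu(\varphi^{n}(F))\big)=\infty$.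 6. There is $F\in\mathcal F$ with $0<\mu(F)<\infty$, $\liminf_n\Phi^{-1}\big(1/\mu(\varphi^{-n}(F))\big)<\infty$ and $\limsup_n\Phi^{-1}\big(1/\mu(\varphi^{-n}(F))\big)=\infty$. 7. There is $F\in\mathcal F$ such that $\chi_F\in L^\Phi(\mu)$ and $\chi_F$ is a semi-irregular vector for $C_\varphi$. Then $(6)\Leftrightarrow(7)\Rightarrow(1)\Rightarrow(2)\Leftrightarrow(3)\Leftarrow(5)\Rightarrow(4)$. Moreover, if $\varphi$ is injective and maps measurable sets to measurable sets, and $\Phi\in\Delta_2$, then $(5)\Rightarrow(6)$. If $\Phi\in\Delta_2$ and $\mu(X)<\infty$, then $(4)\Rightarrow(5)$. Consequently, if $\varphi$ is injective and maps measurable sets to measurable sets, $\Phi\in\Delta_2$ and $\mu(X)<\infty$, then all seven conditions are equivalent. -/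

import Mathlib

open MeasureTheory Measure Filter Topology Set
open scoped ENNReal NNReal

/-- A Young function `Φ : ℝ → [0, ∞]`: convex, even, `Φ 0 = 0`, `Φ x → ∞` as `x → ∞`, and
not identically `∞` away from `0`. -/
structure YoungFunction where
  toFun : ℝ → ℝ≥0∞
  convex' : ConvexOn ℝ≥0 univ toFun
  even' : ∀ x, toFun (-x) = toFun x
  zero' : toFun 0 = 0
  tendsto' : Tendsto toFun atTop (𝓝 ∞)
  exists_lt_top' : ∃ x, 0 < x ∧ toFun x < ∞

namespace YoungFunction

instance : CoeFun YoungFunction (fun _ => ℝ → ℝ≥0∞) := ⟨YoungFunction.toFun⟩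

/-- Generalized inverse `Φ⁻¹(y) = inf {x ≥ 0 : Φ(x) > y}`, for `y ∈ [0, ∞]`; the infimum of the
empty set is `∞`, so that `Φ⁻¹(∞) = ∞`. -/
noncomputable def inv (Φ : YoungFunction) (y : ℝ≥0∞) : ℝ≥0∞ :=
  ⨅ (x : ℝ) (_ : 0 ≤ x) (_ : y < Φ x), ENNReal.ofReal x

/-- The `Δ₂`-condition: `Φ (2 x) ≤ K Φ x < ∞` for all `x ≥ x₀`, for some `K > 0`, `x₀ > 0`. -/
def DeltaTwo (Φ : YoungFunction) : Prop :=
  ∃ (K : ℝ≥0) (x₀ : ℝ), 0 < K ∧ 0 < x₀ ∧ ∀ x, x₀ ≤ x → Φ (2 * x) ≤ K * Φ x ∧ Φ x < ∞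

variable (Φ : YoungFunction)

theorem conv (a b : ℝ) (ha : 0 ≤ a) (hb : 0 ≤ b) (hab : a + b = 1) (x y : ℝ) :
    Φ (a * x + b * y) ≤ ENNReal.ofReal a * Φ x + ENNReal.ofReal b * Φ y := by
  lift a to ℝ≥0 using ha
  lift b to ℝ≥0 using hb
  have h := Φ.convex'.2 (mem_univ x) (mem_univ y) (show 0 ≤ a from zero_le) (show 0 ≤ b from zero_le) (by exact_mod_cast hab)
  simpa [NNReal.smul_def, ENNReal.smul_def] using h

theorem scale (t : ℝ) (h0 : 0 ≤ t) (h1 : t ≤ 1) (x : ℝ) : Φ (t * x) ≤ ENNReal.ofReal t * Φ x := by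
  have h := Φ.conv t (1 - t) h0 (by linarith) (by ring) x 0
  simpa [Φ.zero'] using h

theorem apply_abs (x : ℝ) : Φ |x| = Φ x := by
  rcases abs_choice x with h | h <;> rw [h]
  exact Φ.even' x

theorem mono_abs {x y : ℝ} (h : |x| ≤ |y|) : Φ x ≤ Φ y := by
  rw [← Φ.apply_abs x, ← Φ.apply_abs y]
  rcases (abs_nonneg y).eq_or_lt with h0 | h0
  · have : |x| = 0 := le_antisymm (by linarith) (abs_nonneg x)
    rw [this, ← h0]
  · have h1 := Φ.scale (|x| / |y|) (by positivity) ((div_le_one h0).2 h) |y|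
    rw [div_mul_cancel₀ _ h0.ne'] at h1
    refine h1.trans (mul_le_of_le_one_left (by simp) ?_)
    simpa using (div_le_one h0).2 h

theorem measurable : Measurable Φ := by
  have hm : Monotone fun x : ℝ => Φ (max x 0) := by
    intro x y h
    apply Φ.mono_abs
    rw [abs_of_nonneg (le_max_right _ _), abs_of_nonneg (le_max_right _ _)]
    exact max_le_max h le_rfl
  have h : (Φ : ℝ → ℝ≥0∞) = (fun x : ℝ => Φ (max x 0)) ∘ fun x => |x| := by
    funext x
    simp [Φ.apply_abs]
  rw [h]
  exact hm.measurable.comp measurable_id.abs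

end YoungFunction

section Orlicz

variable {X : Type*} [MeasurableSpace X] (Φ : YoungFunction) {μ : Measure X}

/-- The gauge (Luxemburg) functional `N_Φ(f) = inf {k > 0 : ∫ Φ(f / k) dμ ≤ 1}`. -/
noncomputable def gaugeNorm (f : X →ₘ[μ] ℝ) : ℝ≥0∞ :=
  ⨅ (k : ℝ) (_ : 0 < k) (_ : ∫⁻ x, Φ (f x / k) ∂μ ≤ 1), ENNReal.ofReal k

/-- Membership in the Orlicz space: `∫ Φ(k f) dμ < ∞` for some `k > 0`. -/
def MemOrlicz (f : X →ₘ[μ] ℝ) : Prop := ∃ k : ℝ, 0 < k ∧ ∫⁻ x, Φ (k * f x) ∂μ < ∞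

variable {Φ}

theorem aemeas (f : X →ₘ[μ] ℝ) (k : ℝ) : AEMeasurable (fun x => Φ (f x / k)) μ :=
  Φ.measurable.comp_aemeasurable (f.aestronglyMeasurable.aemeasurable.div_const k)

theorem gaugeNorm_le {f : X →ₘ[μ] ℝ} {k : ℝ} (hk : 0 < k) (h : ∫⁻ x, Φ (f x / k) ∂μ ≤ 1) :
    gaugeNorm Φ f ≤ ENNReal.ofReal k :=
  iInf_le_of_le k (iInf_le_of_le hk (iInf_le _ h))

theorem memOrlicz_iff {f : X →ₘ[μ] ℝ} :
    MemOrlicz Φ f ↔ ∃ k : ℝ, 0 < k ∧ ∫⁻ x, Φ (f x / k) ∂μ ≤ 1 := by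
  constructor
  · rintro ⟨k, hk, h⟩
    set M := ∫⁻ x, Φ (k * f x) ∂μ with hM
    have hM0 : 0 ≤ M.toReal := ENNReal.toReal_nonneg
    set t : ℝ := (M.toReal + 1)⁻¹ with ht
    have ht0 : 0 < t := by positivity
    have ht1 : t ≤ 1 := inv_le_one_of_one_le₀ (by linarith)
    refine ⟨(t * k)⁻¹, by positivity, ?_⟩
    calc ∫⁻ x, Φ (f x / (t * k)⁻¹) ∂μ ≤ ∫⁻ x, ENNReal.ofReal t * Φ (k * f x) ∂μ := by
          refine lintegral_mono fun x => ?_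
          have := Φ.scale t ht0.le ht1 (k * f x)
          rwa [← mul_assoc, mul_comm, ← div_inv_eq_mul] at this
      _ = ENNReal.ofReal t * M := by rw [lintegral_const_mul' _ _ ENNReal.ofReal_ne_top]
      _ = ENNReal.ofReal (t * M.toReal) := by
          rw [ENNReal.ofReal_mul ht0.le, ENNReal.ofReal_toReal h.ne]
      _ ≤ 1 := by
          rw [← ENNReal.ofReal_one]
          apply ENNReal.ofReal_le_ofReal
          rw [ht, inv_mul_le_iff₀ (by linarith)]
          linarith
  · rintro ⟨k, hk, h⟩
    refine ⟨k⁻¹, by positivity, ?_⟩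
    simp only [inv_mul_eq_div]
    exact h.trans_lt ENNReal.one_lt_top

theorem MemOrlicz.gaugeNorm_lt_top {f : X →ₘ[μ] ℝ} (hf : MemOrlicz Φ f) : gaugeNorm Φ f < ∞ := by
  obtain ⟨k, hk, h⟩ := memOrlicz_iff.1 hf
  exact (gaugeNorm_le hk h).trans_lt ENNReal.ofReal_lt_top

theorem modular_add {f g : X →ₘ[μ] ℝ} {k l : ℝ} (hk : 0 < k) (hl : 0 < l)
    (hf : ∫⁻ x, Φ (f x / k) ∂μ ≤ 1) (hg : ∫⁻ x, Φ (g x / l) ∂μ ≤ 1) :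
    ∫⁻ x, Φ ((f + g : X →ₘ[μ] ℝ) x / (k + l)) ∂μ ≤ 1 := by
  have hkl : 0 < k + l := by linarith
  have hab : k / (k + l) + l / (k + l) = 1 := by field_simp
  calc ∫⁻ x, Φ ((f + g : X →ₘ[μ] ℝ) x / (k + l)) ∂μ
      ≤ ∫⁻ x, ENNReal.ofReal (k / (k + l)) * Φ (f x / k)
          + ENNReal.ofReal (l / (k + l)) * Φ (g x / l) ∂μ := by
        refine lintegral_mono_ae ?_
        filter_upwards [AEEqFun.coeFn_add f g] with x hx
        rw [hx, Pi.add_apply]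
        have := Φ.conv (k / (k + l)) (l / (k + l)) (by positivity) (by positivity) hab
          (f x / k) (g x / l)
        convert this using 2
        field_simp
    _ = ENNReal.ofReal (k / (k + l)) * ∫⁻ x, Φ (f x / k) ∂μ
          + ENNReal.ofReal (l / (k + l)) * ∫⁻ x, Φ (g x / l) ∂μ := by
        rw [lintegral_add_left' ((aemeas f k).const_mul _),
          lintegral_const_mul' _ _ ENNReal.ofReal_ne_top,
          lintegral_const_mul' _ _ ENNReal.ofReal_ne_top]
    _ ≤ ENNReal.ofReal (k / (k + l)) * 1 + ENNReal.ofReal (l / (k + l)) * 1 := by gcongr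
    _ = 1 := by
        rw [mul_one, mul_one, ← ENNReal.ofReal_add (by positivity) (by positivity), hab,
          ENNReal.ofReal_one]

theorem modular_smul {f : X →ₘ[μ] ℝ} {k c : ℝ} (hc : c ≠ 0)
    (hf : ∫⁻ x, Φ (f x / k) ∂μ ≤ 1) :
    ∫⁻ x, Φ ((c • f : X →ₘ[μ] ℝ) x / (|c| * k)) ∂μ ≤ 1 := by
  refine le_trans (lintegral_mono_ae ?_) hf
  filter_upwards [AEEqFun.coeFn_smul c f] with x hx
  rw [hx, Pi.smul_apply, smul_eq_mul]
  apply Φ.mono_abs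
  rw [abs_div, abs_mul, abs_mul, abs_abs, abs_div, mul_div_mul_left _ _ (abs_ne_zero.2 hc)]

theorem gaugeNorm_add (f g : X →ₘ[μ] ℝ) :
    gaugeNorm Φ (f + g) ≤ gaugeNorm Φ f + gaugeNorm Φ g := by
  rw [gaugeNorm.eq_def Φ f, gaugeNorm.eq_def Φ g]
  simp only [ENNReal.iInf_add, ENNReal.add_iInf]
  refine le_iInf fun k => le_iInf fun hk => le_iInf fun h => le_iInf fun l => le_iInf fun hl =>
    le_iInf fun h' => ?_
  rw [← ENNReal.ofReal_add hl.le hk.le]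
  exact gaugeNorm_le (by linarith) (modular_add hl hk h' h)

theorem gaugeNorm_smul_le {c : ℝ} (hc : c ≠ 0) (f : X →ₘ[μ] ℝ) :
    gaugeNorm Φ (c • f) ≤ ENNReal.ofReal |c| * gaugeNorm Φ f := by
  have hc' : ENNReal.ofReal |c| ≠ 0 := by simpa using hc
  rw [gaugeNorm.eq_def Φ f]
  simp only [ENNReal.mul_iInf_of_ne hc' ENNReal.ofReal_ne_top]
  refine le_iInf fun k => le_iInf fun hk => le_iInf fun h => ?_
  rw [← ENNReal.ofReal_mul (abs_nonneg c)]
  exact gaugeNorm_le (mul_pos (abs_pos.2 hc) hk) (modular_smul hc h)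

theorem gaugeNorm_zero : gaugeNorm Φ (0 : X →ₘ[μ] ℝ) = 0 := by
  refine le_antisymm (ENNReal.le_of_forall_pos_le_add fun ε hε _ => ?_) (by simp)
  rw [zero_add, ← ENNReal.ofReal_coe_nnreal]
  refine gaugeNorm_le (by exact_mod_cast hε) ?_
  rw [lintegral_congr_ae (g := fun _ => 0)]
  · simp
  · filter_upwards [AEEqFun.coeFn_zero (α := X) (β := ℝ) (μ := μ)] with x hx
    simp [hx, Φ.zero']

theorem gaugeNorm_smul (c : ℝ) (f : X →ₘ[μ] ℝ) :
    gaugeNorm Φ (c • f) = ENNReal.ofReal |c| * gaugeNorm Φ f := by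
  rcases eq_or_ne c 0 with rfl | hc
  · simp [gaugeNorm_zero]
  · refine le_antisymm (gaugeNorm_smul_le hc f) ?_
    have h := gaugeNorm_smul_le (Φ := Φ) (inv_ne_zero hc) (c • f)
    rw [smul_smul, inv_mul_cancel₀ hc, one_smul] at h
    calc ENNReal.ofReal |c| * gaugeNorm Φ f
        ≤ ENNReal.ofReal |c| * (ENNReal.ofReal |c⁻¹| * gaugeNorm Φ (c • f)) := by gcongr
      _ = gaugeNorm Φ (c • f) := by
        rw [← mul_assoc, ← ENNReal.ofReal_mul (abs_nonneg c), ← abs_mul, mul_inv_cancel₀ hc]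
        simp

theorem eq_zero_of_gaugeNorm {f : X →ₘ[μ] ℝ} (hf : gaugeNorm Φ f = 0) : f = 0 := by
  have key : ∀ δ : ℝ, 0 < δ → μ {x | δ ≤ |f x|} = 0 := by
    intro δ hδ
    set m := μ {x | δ ≤ |f x|}
    have hmod : ∀ ε : ℝ, 0 < ε → Φ (δ / ε) * m ≤ 1 := by
      intro ε hε
      have h1 : gaugeNorm Φ f < ENNReal.ofReal ε := by simpa [hf] using hε
      simp only [gaugeNorm, iInf_lt_iff] at h1
      obtain ⟨k, hk, h, hlt⟩ := h1
      have hkε : k ≤ ε := ((ENNReal.ofReal_lt_ofReal_iff hε).1 hlt).le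
      refine le_trans ?_ h
      refine le_trans ?_ (mul_meas_ge_le_lintegral₀ (aemeas f k) (Φ (δ / ε)))
      gcongr
      refine measure_mono fun x (hx : δ ≤ |f x|) => ?_
      apply Φ.mono_abs
      rw [abs_div, abs_div, abs_of_pos hδ, abs_of_pos hε, abs_of_pos hk]
      gcongr
    by_contra hm
    have hlim : Tendsto (fun t : ℝ => Φ (δ * t)) atTop (𝓝 ∞) :=
      Φ.tendsto'.comp (tendsto_id.const_mul_atTop hδ)
    have hfin : (1 / m) < ∞ := by
      rw [one_div]; exact ENNReal.inv_lt_top.2 (pos_iff_ne_zero.2 hm)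
    obtain ⟨t, ht, ht0⟩ := ((hlim.eventually (lt_mem_nhds hfin)).and
      (eventually_gt_atTop (0 : ℝ))).exists
    have h2 := hmod t⁻¹ (by positivity)
    rw [div_inv_eq_mul] at h2
    have h3 : Φ (δ * t) ≤ 1 / m := by
      rw [ENNReal.le_div_iff_mul_le (Or.inl hm) (Or.inr ENNReal.one_ne_top)]
      exact h2
    exact absurd ht (not_lt.2 h3)
  apply AEEqFun.ext
  refine EventuallyEq.trans ?_ (AEEqFun.coeFn_zero (α := X) (β := ℝ) (μ := μ)).symm
  have h : ∀ᵐ x ∂μ, ∀ n : ℕ, ¬ (1 / ((n : ℝ) + 1) ≤ |f x|) := by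
    rw [ae_all_iff]
    intro n
    rw [ae_iff]
    simpa using key (1 / ((n : ℝ) + 1)) (by positivity)
  filter_upwards [h] with x hx
  by_contra hne
  obtain ⟨n, hn⟩ := exists_nat_one_div_lt (abs_pos.2 hne)
  exact hx n hn.le

variable (Φ μ)

/-- The Orlicz space `L^Φ(μ)`, a space of classes of a.e. equal functions. -/
noncomputable def OrliczSpace : Submodule ℝ (X →ₘ[μ] ℝ) where
  carrier := {f | MemOrlicz Φ f}
  add_mem' := by
    intro f g hf hg
    obtain ⟨k, hk, h⟩ := memOrlicz_iff.1 hf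
    obtain ⟨l, hl, h'⟩ := memOrlicz_iff.1 hg
    exact memOrlicz_iff.2 ⟨k + l, by linarith, modular_add hk hl h h'⟩
  zero_mem' := by
    refine ⟨1, one_pos, ?_⟩
    rw [lintegral_congr_ae (g := fun _ => 0)]
    · simp
    · filter_upwards [AEEqFun.coeFn_zero (α := X) (β := ℝ) (μ := μ)] with x hx
      simp [hx, Φ.zero']
  smul_mem' := by
    intro c f hf
    rcases eq_or_ne c 0 with rfl | hc
    · refine ⟨1, one_pos, ?_⟩
      rw [lintegral_congr_ae (g := fun _ => 0)]
      · simp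
      · filter_upwards [AEEqFun.coeFn_smul (0 : ℝ) f] with x hx
        rw [hx]
        simp [Φ.zero']
    · obtain ⟨k, hk, h⟩ := memOrlicz_iff.1 hf
      exact memOrlicz_iff.2 ⟨|c| * k, mul_pos (abs_pos.2 hc) hk, modular_smul hc h⟩

variable {Φ μ}

theorem mem_orliczSpace {f : X →ₘ[μ] ℝ} : f ∈ OrliczSpace Φ μ ↔ MemOrlicz Φ f := Iff.rfl

noncomputable instance : Norm (OrliczSpace Φ μ) :=
  ⟨fun f => (gaugeNorm Φ (f : X →ₘ[μ] ℝ)).toReal⟩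

theorem OrliczSpace.norm_def (f : OrliczSpace Φ μ) :
    ‖f‖ = (gaugeNorm Φ (f : X →ₘ[μ] ℝ)).toReal := rfl

theorem OrliczSpace.core : NormedSpace.Core ℝ (OrliczSpace Φ μ) where
  norm_nonneg f := ENNReal.toReal_nonneg
  norm_smul c f := by
    simp [OrliczSpace.norm_def, gaugeNorm_smul, ENNReal.toReal_mul]
  norm_triangle f g := by
    rw [OrliczSpace.norm_def, OrliczSpace.norm_def, OrliczSpace.norm_def, Submodule.coe_add,
      ← ENNReal.toReal_add (MemOrlicz.gaugeNorm_lt_top f.2).ne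
        (MemOrlicz.gaugeNorm_lt_top g.2).ne]
    exact ENNReal.toReal_mono (ENNReal.add_ne_top.2 ⟨(MemOrlicz.gaugeNorm_lt_top f.2).ne,
      (MemOrlicz.gaugeNorm_lt_top g.2).ne⟩) (gaugeNorm_add _ _)
  norm_eq_zero_iff f := by
    rw [OrliczSpace.norm_def, ENNReal.toReal_eq_zero_iff]
    constructor
    · rintro (h | h)
      · exact Subtype.ext (eq_zero_of_gaugeNorm h)
      · exact absurd h (MemOrlicz.gaugeNorm_lt_top f.2).ne
    · rintro rfl
      exact Or.inl gaugeNorm_zero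

noncomputable instance : NormedAddCommGroup (OrliczSpace Φ μ) :=
  NormedAddCommGroup.ofCore OrliczSpace.core

noncomputable instance : NormedSpace ℝ (OrliczSpace Φ μ) :=
  NormedSpace.ofCore OrliczSpace.core

theorem OrliczSpace.enorm_eq (f : OrliczSpace Φ μ) :
    ‖f‖ₑ = gaugeNorm Φ (f : X →ₘ[μ] ℝ) := by
  rw [← ofReal_norm, OrliczSpace.norm_def,
    ENNReal.ofReal_toReal (MemOrlicz.gaugeNorm_lt_top f.2).ne]

/-! ### Composition operators -/

variable (Φ)

/-- `f ∘ φ ∈ L^Φ(μ)` for every `f ∈ L^Φ(μ)`, i.e. `C_φ` is well defined on `L^Φ(μ)`. -/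
def CompMapsOrlicz {φ : X → X} (hφ : QuasiMeasurePreserving φ μ μ) : Prop :=
  ∀ f ∈ OrliczSpace Φ μ, f.compQuasiMeasurePreserving φ hφ ∈ OrliczSpace Φ μ

theorem comp_add' {φ : X → X} (hφ : QuasiMeasurePreserving φ μ μ) (f g : X →ₘ[μ] ℝ) :
    (f + g).compQuasiMeasurePreserving φ hφ =
      f.compQuasiMeasurePreserving φ hφ + g.compQuasiMeasurePreserving φ hφ := by
  apply AEEqFun.ext
  filter_upwards [(f + g).coeFn_compQuasiMeasurePreserving hφ,
    f.coeFn_compQuasiMeasurePreserving hφ, g.coeFn_compQuasiMeasurePreserving hφ,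
    AEEqFun.coeFn_add (f.compQuasiMeasurePreserving φ hφ) (g.compQuasiMeasurePreserving φ hφ),
    hφ.ae_eq_comp (AEEqFun.coeFn_add f g)] with x h1 h2 h3 h4 h5
  rw [h1, h4, h5, Pi.add_apply, h2, h3]
  rfl

theorem comp_smul' {φ : X → X} (hφ : QuasiMeasurePreserving φ μ μ) (c : ℝ) (f : X →ₘ[μ] ℝ) :
    (c • f).compQuasiMeasurePreserving φ hφ = c • f.compQuasiMeasurePreserving φ hφ := by
  apply AEEqFun.ext
  filter_upwards [(c • f).coeFn_compQuasiMeasurePreserving hφ,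
    f.coeFn_compQuasiMeasurePreserving hφ,
    AEEqFun.coeFn_smul c (f.compQuasiMeasurePreserving φ hφ),
    hφ.ae_eq_comp (AEEqFun.coeFn_smul c f)] with x h1 h2 h3 h4
  rw [h1, h3, h4, Pi.smul_apply, h2]
  rfl

/-- The composition operator `C_φ f = f ∘ φ` on `L^Φ(μ)`. -/
noncomputable def compOp {φ : X → X} (hφ : QuasiMeasurePreserving φ μ μ)
    (h : CompMapsOrlicz Φ hφ) : OrliczSpace Φ μ →ₗ[ℝ] OrliczSpace Φ μ where
  toFun f := ⟨(f : X →ₘ[μ] ℝ).compQuasiMeasurePreserving φ hφ, h f f.2⟩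
  map_add' f g := Subtype.ext (comp_add' hφ f g)
  map_smul' c f := Subtype.ext (comp_smul' hφ c f)

variable {Φ}

theorem modular_comp {φ : X → X} (hφ : QuasiMeasurePreserving φ μ μ) {c : ℝ} (hc : 1 ≤ c)
    (hb : ∀ F, MeasurableSet F → μ (φ ⁻¹' F) ≤ ENNReal.ofReal c * μ F) {f : X →ₘ[μ] ℝ} {k : ℝ}
    (h : ∫⁻ x, Φ (f x / k) ∂μ ≤ 1) :
    ∫⁻ x, Φ (f.compQuasiMeasurePreserving φ hφ x / (c * k)) ∂μ ≤ 1 := by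
  have hc0 : 0 < c := by linarith
  have hle : map φ μ ≤ ENNReal.ofReal c • μ := by
    refine Measure.le_iff.2 fun F hF => ?_
    rw [map_apply hφ.measurable hF]
    simpa using hb F hF
  calc ∫⁻ x, Φ (f.compQuasiMeasurePreserving φ hφ x / (c * k)) ∂μ
      ≤ ∫⁻ x, ENNReal.ofReal c⁻¹ * Φ (f (φ x) / k) ∂μ := by
        refine lintegral_mono_ae ?_
        filter_upwards [f.coeFn_compQuasiMeasurePreserving hφ] with x hx
        have h1 := Φ.scale c⁻¹ (by positivity) (inv_le_one_of_one_le₀ hc) (f (φ x) / k)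
        have h2 : f.compQuasiMeasurePreserving φ hφ x / (c * k) = c⁻¹ * (f (φ x) / k) := by
          rw [hx, Function.comp_apply]; simp only [div_eq_mul_inv, mul_inv]; ring
        rwa [h2]
    _ = ENNReal.ofReal c⁻¹ * ∫⁻ x, Φ (f x / k) ∂(map φ μ) := by
        rw [lintegral_const_mul' _ _ ENNReal.ofReal_ne_top,
          lintegral_map' ((aemeas f k).mono_ac hφ.absolutelyContinuous) hφ.aemeasurable]
    _ ≤ ENNReal.ofReal c⁻¹ * ∫⁻ x, Φ (f x / k) ∂(ENNReal.ofReal c • μ) := by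
        gcongr
    _ = ∫⁻ x, Φ (f x / k) ∂μ := by
        rw [lintegral_smul_measure, smul_eq_mul, ← mul_assoc,
          ← ENNReal.ofReal_mul (by positivity), inv_mul_cancel₀ hc0.ne', ENNReal.ofReal_one,
          one_mul]
    _ ≤ 1 := h

theorem exists_bound {φ : X → X} {c' : ℝ}
    (hb : ∀ F, MeasurableSet F → μ (φ ⁻¹' F) ≤ ENNReal.ofReal c' * μ F) :
    ∃ c : ℝ, 1 ≤ c ∧ ∀ F, MeasurableSet F → μ (φ ⁻¹' F) ≤ ENNReal.ofReal c * μ F :=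
  ⟨max c' 1, le_max_right _ _, fun F hF => (hb F hF).trans
    (mul_le_mul_left (ENNReal.ofReal_le_ofReal (le_max_left _ _)) _)⟩

/-- The condition `μ(φ⁻¹ F) ≤ c μ(F)` makes `C_φ` a well-defined operator on `L^Φ(μ)`. -/
theorem compMapsOrlicz_of_bound {φ : X → X} (hφ : QuasiMeasurePreserving φ μ μ) {c' : ℝ}
    (hb' : ∀ F, MeasurableSet F → μ (φ ⁻¹' F) ≤ ENNReal.ofReal c' * μ F) :
    CompMapsOrlicz Φ hφ := by
  obtain ⟨c, hc, hb⟩ := exists_bound hb'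
  intro f hf
  obtain ⟨k, hk, h⟩ := memOrlicz_iff.1 hf
  exact memOrlicz_iff.2 ⟨c * k, by positivity, modular_comp hφ hc hb h⟩

/-- The condition `μ(φ⁻¹ F) ≤ c μ(F)` makes `C_φ` continuous on `L^Φ(μ)`. -/
theorem continuous_compOp_of_bound {φ : X → X} (hφ : QuasiMeasurePreserving φ μ μ) {c' : ℝ}
    (hb' : ∀ F, MeasurableSet F → μ (φ ⁻¹' F) ≤ ENNReal.ofReal c' * μ F)
    (h : CompMapsOrlicz Φ hφ) : Continuous (compOp Φ hφ h) := by
  obtain ⟨c, hc, hb⟩ := exists_bound hb'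
  have hc0 : 0 < c := by linarith
  refine AddMonoidHomClass.continuous_of_bound (compOp Φ hφ h) c fun f => ?_
  have key : gaugeNorm Φ (compOp Φ hφ h f : X →ₘ[μ] ℝ)
      ≤ ENNReal.ofReal c * gaugeNorm Φ (f : X →ₘ[μ] ℝ) := by
    rw [gaugeNorm.eq_def Φ (f : X →ₘ[μ] ℝ)]
    simp only [ENNReal.mul_iInf_of_ne (ENNReal.ofReal_pos.2 hc0).ne' ENNReal.ofReal_ne_top]
    refine le_iInf fun k => le_iInf fun hk => le_iInf fun h' => ?_
    rw [← ENNReal.ofReal_mul hc0.le]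
    exact gaugeNorm_le (by positivity) (modular_comp hφ hc hb h')
  rw [OrliczSpace.norm_def, OrliczSpace.norm_def]
  have := ENNReal.toReal_mono (ENNReal.mul_ne_top ENNReal.ofReal_ne_top
    (MemOrlicz.gaugeNorm_lt_top f.2).ne) key
  rwa [ENNReal.toReal_mul, ENNReal.toReal_ofReal hc0.le] at this

/-- The class of the characteristic function `χ_F` of a measurable set. -/
noncomputable def chi (μ : Measure X) {F : Set X} (hF : MeasurableSet F) : X →ₘ[μ] ℝ :=
  AEEqFun.mk (F.indicator fun _ => (1 : ℝ))
    (stronglyMeasurable_const.indicator hF).aestronglyMeasurable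

end Orlicz

/-! ### Li-Yorke chaos -/

/-- `(x, y)` is a Li-Yorke pair for `T`: `liminf d(Tⁿx, Tⁿy) = 0` and `limsup d(Tⁿx, Tⁿy) > 0`. -/
def IsLiYorkePair {M : Type*} [MetricSpace M] (T : M → M) (x y : M) : Prop :=
  liminf (fun n : ℕ => edist (T^[n] x) (T^[n] y)) atTop = 0 ∧
    0 < limsup (fun n : ℕ => edist (T^[n] x) (T^[n] y)) atTop

/-- `T` is Li-Yorke chaotic: there is an uncountable set each pair of distinct points of which is
a Li-Yorke pair. -/
def LiYorkeChaotic {M : Type*} [MetricSpace M] (T : M → M) : Prop :=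
  ∃ S : Set M, ¬ S.Countable ∧ ∀ x ∈ S, ∀ y ∈ S, x ≠ y → IsLiYorkePair T x y

/-- `x` is semi-irregular for `T`: `liminf ‖Tⁿx‖ = 0` and `limsup ‖Tⁿx‖ > 0`. -/
def IsSemiIrregular {E : Type*} [NormedAddCommGroup E] (T : E → E) (x : E) : Prop :=
  liminf (fun n : ℕ => ‖T^[n] x‖ₑ) atTop = 0 ∧ 0 < limsup (fun n : ℕ => ‖T^[n] x‖ₑ) atTop

/-! ### The seven conditions -/

section Conditions

variable {X : Type*} [MeasurableSpace X] (Φ : YoungFunction) (μ : Measure X) (φ : X → X)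

/-- `Φ⁻¹(1 / μ(φ⁻ⁿ(F)))`. -/
noncomputable def youngInvPreimage (F : Set X) (n : ℕ) : ℝ≥0∞ := Φ.inv (1 / μ (φ^[n] ⁻¹' F))

/-- `Φ⁻¹(1 / μ(φⁿ(F)))`. If `φⁿ(F)` is not measurable, `μ` denotes the outer measure. -/
noncomputable def youngInvImage (F : Set X) (n : ℕ) : ℝ≥0∞ := Φ.inv (1 / μ (φ^[n] '' F))

/-- Some `F` of positive finite measure has `limsup Φ⁻¹(1 / μ(φ⁻ⁿ(F))) = ∞`. -/
def BackwardVanishing : Prop :=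
  ∃ F, MeasurableSet F ∧ 0 < μ F ∧ μ F < ∞ ∧ limsup (youngInvPreimage Φ μ φ F) atTop = ∞

/-- Some `F` of positive finite measure has `limsup Φ⁻¹(1 / μ(φⁿ(F))) = ∞`. -/
def ForwardVanishing : Prop :=
  ∃ F, MeasurableSet F ∧ 0 < μ F ∧ μ F < ∞ ∧ limsup (youngInvImage Φ μ φ F) atTop = ∞

/-- One and the same `F` has both preceding properties. -/
def TwoSidedVanishing : Prop :=
  ∃ F, MeasurableSet F ∧ 0 < μ F ∧ μ F < ∞ ∧
    limsup (youngInvPreimage Φ μ φ F) atTop = ∞ ∧ limsup (youngInvImage Φ μ φ F) atTop = ∞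

/-- Some `F` of positive finite measure has `liminf Φ⁻¹(1 / μ(φ⁻ⁿ(F))) < ∞` and
`limsup Φ⁻¹(1 / μ(φ⁻ⁿ(F))) = ∞`. -/
def BackwardOscillating : Prop :=
  ∃ F, MeasurableSet F ∧ 0 < μ F ∧ μ F < ∞ ∧
    liminf (youngInvPreimage Φ μ φ F) atTop < ∞ ∧ limsup (youngInvPreimage Φ μ φ F) atTop = ∞

variable {μ φ}

/-- Some nonzero `f ∈ L^Φ(μ)` has `liminf N_Φ(C_φⁿ f) = 0`. -/
def HasVanishingOrbit (hφ : QuasiMeasurePreserving φ μ μ) (h : CompMapsOrlicz Φ hφ) : Prop :=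
  ∃ f : OrliczSpace Φ μ, f ≠ 0 ∧
    liminf (fun n : ℕ => gaugeNorm Φ ((compOp Φ hφ h)^[n] f : X →ₘ[μ] ℝ)) atTop = 0

/-- Some characteristic function in `L^Φ(μ)` is a semi-irregular vector for `C_φ`. -/
def HasSemiIrregularChi (hφ : QuasiMeasurePreserving φ μ μ) (h : CompMapsOrlicz Φ hφ) : Prop :=
  ∃ (F : Set X) (hF : MeasurableSet F) (hmem : chi μ hF ∈ OrliczSpace Φ μ),
    IsSemiIrregular (compOp Φ hφ h) ⟨chi μ hF, hmem⟩

end Conditions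

/-!
The bridge between the Orlicz space and the measure is the identity
`N_Φ(χ_F) = 1 / Φ⁻¹(1 / μ F)` (`gaugeNorm_chi`), together with `C_φⁿ χ_F = χ_{φ⁻ⁿ F}`: every
condition on `Φ⁻¹(1 / μ(φ⁻ⁿ F))` is a condition on the orbit of `χ_F`. With it, the implications
that need no extra hypothesis are short. A semi-irregular vector spans a line of pairwise Li-Yorke
points; the difference of a Li-Yorke pair has a vanishing orbit; and a nonzero `f` dominates a
multiple of some `χ_F` with `0 < μ F < ∞`.

Under `Δ₂` the function `Φ` is finite, so `Φ⁻¹(1 / m) → ∞` exactly when `m → 0`, and continuity of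
`C_φ` says that preimages of small sets are small (`PreimageSmall`). What remains is about measures
of images and preimages of sets only.

* `exists_measure_preimage_oscillating`: if `μ(φ⁻ⁿ F) → 0` and `μ(φⁿ F) → 0` along a subsequence,
  a sparse union `G = ⋃ φ^{n_i} F` has small preimages `φ^{-m_k} G`, while each `φ^{-n_i} G`
  contains `F`.
* `exists_tendsto_measure_preimage_and_image`: if `μ X < ∞` and `F` is contracted by iterates of
  `φ`, so is each `A J = ⋃ j ≤ J, φ⁻ʲ F`. Removing small sets containing `φ^{n_J} (A J)` from
  `⋃ J, A J` leaves a set whose `n_J`-th preimage is disjoint from `A J`, hence small.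
* `exists_tendsto_measure_image`: the analogous passage from small preimages to small forward
  images. It works on the invariant set of points that visit `F` infinitely often; if this set is
  null, `F` contains a wandering set of positive measure instead, and its disjoint forward images
  have summable measures. This closes the circle of equivalences for injective `φ` on a finite
  measure space.
-/

/-! ### Sequences of extended nonnegative reals -/

theorem ENNReal.limsup_eq_top_iff_exists_tendsto {u : ℕ → ℝ≥0∞} :
    limsup u atTop = ∞ ↔ ∃ ψ : ℕ → ℕ, StrictMono ψ ∧ Tendsto (u ∘ ψ) atTop (𝓝 ∞) := by
  constructor
  · intro h
    obtain ⟨ψ, hψ, hu⟩ := extraction_forall_of_frequently (P := fun n k => (n : ℝ≥0∞) < u k)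
      fun n => frequently_lt_of_lt_limsup (by isBoundedDefault) (by rw [h]; simp)
    refine ⟨ψ, hψ, ENNReal.tendsto_nhds_top fun n => ?_⟩
    filter_upwards [eventually_ge_atTop n] with k hk
    exact (Nat.cast_le.2 hk).trans_lt (hu k)
  · rintro ⟨ψ, hψ, hu⟩
    refine top_le_iff.1 ?_
    rw [← hu.limsup_eq]
    exact hψ.tendsto_atTop.limsup_comp_le_limsup

/-- If the rows and the columns of `b` tend to `0`, then along suitable subsequences of rows and
columns the entries are bounded by a summable double sequence, and so is column `0`. -/
theorem exists_strictMono_le_two_inv_pow_mul {b : ℕ → ℕ → ℝ≥0∞}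
    (hrow : ∀ k, Tendsto (fun m => b k m) atTop (𝓝 0))
    (hcol : ∀ m, Tendsto (fun k => b k m) atTop (𝓝 0)) :
    ∃ κ τ : ℕ → ℕ, StrictMono κ ∧ StrictMono τ ∧
      (∀ i k, b (κ i) (τ k) ≤ 2⁻¹ ^ i * 2⁻¹ ^ k) ∧ ∀ i, b (κ i) 0 ≤ 2⁻¹ ^ i := by
  -- `2⁻¹ ^ (2 * s)` leaves a factor `2⁻¹ ^ s` for each of the two indices when both are at most `s`
  have hpos : ∀ s : ℕ, (0 : ℝ≥0∞) < 2⁻¹ ^ (2 * s) := fun s =>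
    ENNReal.pow_pos (by simp) _
  have hM : ∀ s : ℕ, ∃ m > s, ∀ i ≤ s, b i m < 2⁻¹ ^ (2 * s) := by
    intro s
    have h : ∀ᶠ m in atTop, ∀ i ∈ Finset.Iic s, b i m < 2⁻¹ ^ (2 * s) :=
      (Finset.eventually_all _).2 fun i _ => (hrow i).eventually (gt_mem_nhds (hpos s))
    obtain ⟨m, hm, hm'⟩ := (h.and (eventually_gt_atTop s)).exists
    exact ⟨m, hm', fun i hi => hm i (Finset.mem_Iic.2 hi)⟩
  have hK : ∀ s : ℕ, ∃ k > s, ∀ j ≤ s, b k j < 2⁻¹ ^ (2 * s) := by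
    intro s
    have h : ∀ᶠ k in atTop, ∀ j ∈ Finset.Iic s, b k j < 2⁻¹ ^ (2 * s) :=
      (Finset.eventually_all _).2 fun i _ => (hcol i).eventually (gt_mem_nhds (hpos s))
    obtain ⟨m, hm, hm'⟩ := (h.and (eventually_gt_atTop s)).exists
    exact ⟨m, hm', fun i hi => hm i (Finset.mem_Iic.2 hi)⟩
  -- choose rows and columns alternately, each beyond the previous choice
  choose M hMs hMb using hM
  choose K hKs hKb using hK
  let κ : ℕ → ℕ := fun n => Nat.rec (K 0) (fun _ s => K (M s)) n
  have hκs : ∀ n, κ (n + 1) = K (M (κ n)) := fun n => rfl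
  have hκ : StrictMono κ := strictMono_nat_of_lt_succ fun n => by
    rw [hκs]; exact (hMs _).trans (hKs _)
  have hτ : StrictMono fun n => M (κ n) := strictMono_nat_of_lt_succ fun n => by
    simp only [hκs]; exact (hKs _).trans (hMs _)
  have hle : ∀ {p q : ℕ}, q ≤ p → (2⁻¹ : ℝ≥0∞) ^ p ≤ 2⁻¹ ^ q := fun h =>
    pow_le_pow_right_of_le_one' (by simp) h
  refine ⟨κ, fun n => M (κ n), hκ, hτ, fun i k => ?_, fun i => ?_⟩
  · rw [← pow_add]
    rcases le_or_gt i k with hik | hik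
    · refine (hMb (κ k) (κ i) (hκ.monotone hik)).le.trans (hle ?_)
      have := hκ.le_apply (x := k)
      omega
    · obtain ⟨i, rfl⟩ := Nat.exists_eq_add_one.2 (Nat.zero_lt_of_lt hik)
      refine (hKb (M (κ i)) _ (hτ.monotone (Nat.le_of_lt_succ hik))).le.trans (hle ?_)
      have := hκ.le_apply (x := i)
      have := hMs (κ i)
      omega
  · rcases i with _ | i
    · exact (hKb 0 0 le_rfl).le.trans (hle (by omega))
    · refine (hKb (M (κ i)) 0 (Nat.zero_le _)).le.trans (hle ?_)
      have := hκ.le_apply (x := i)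
      have := hMs (κ i)
      omega

/-! ### Measures of preimages and images under iterates -/

section Dynamics

variable {X : Type*} [MeasurableSpace X] {μ : Measure X} {φ : X → X}

/-- Preimages under `φ` of measurable sets of small measure have small measure, expressed with
sequences. Unlike absolute continuity of `φ_* μ`, this is a uniform condition also when `μ` is
infinite. -/
def PreimageSmall (μ : Measure X) (φ : X → X) : Prop :=
  ∀ H : ℕ → Set X, (∀ k, MeasurableSet (H k)) → Tendsto (fun k => μ (H k)) atTop (𝓝 0) →
    Tendsto (fun k => μ (φ ⁻¹' H k)) atTop (𝓝 0)

theorem PreimageSmall.iterate (h : PreimageSmall μ φ) (hφ : Measurable φ) (j : ℕ) :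
    PreimageSmall μ φ^[j] := by
  induction j with
  | zero => intro H _ h0; simpa using h0
  | succ j ih =>
    intro H hH h0
    rw [Function.iterate_succ]
    exact h _ (fun k => hφ.iterate j (hH k)) (ih H hH h0)

theorem measurableSet_accumulate {A : ℕ → Set X} (hA : ∀ n, MeasurableSet (A n)) (J : ℕ) :
    MeasurableSet (accumulate A J) := by
  rw [accumulate_def]
  exact MeasurableSet.biUnion (to_countable _) fun j _ => hA j

theorem measure_accumulate_le (A : ℕ → Set X) (J : ℕ) :
    μ (accumulate A J) ≤ ∑ j ∈ Finset.Iic J, μ (A j) := by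
  have : accumulate A J = ⋃ j ∈ Finset.Iic J, A j := by simp [accumulate_def]
  rw [this]
  exact measure_biUnion_finset_le _ _

theorem tendsto_measure_iUnion_diff_accumulate [IsFiniteMeasure μ] {A : ℕ → Set X}
    (hA : ∀ n, MeasurableSet (A n)) :
    Tendsto (fun J => μ ((⋃ j, A j) \ accumulate A J)) atTop (𝓝 0) := by
  have h := tendsto_measure_iInter_atTop (μ := μ) (s := fun J => (⋃ j, A j) \ accumulate A J)
    (fun J => ((MeasurableSet.iUnion hA).diff (measurableSet_accumulate hA J)).nullMeasurableSet)
    (fun i j hij => sdiff_subset_sdiff_right (monotone_accumulate hij)) ⟨0, measure_ne_top _ _⟩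
  rwa [← sdiff_iUnion, iUnion_accumulate, sdiff_self, measure_empty] at h

/-- In a finite measure space a set whose forward images are small along a subsequence yields a
set with the same property whose preimages are small along a subsequence as well.

With `A J = ⋃ j ≤ J, φ⁻ʲ F` and `E = ⋃ J, A J`, each `A J` is contracted by some iterate `n_J`
into a set `H J`, where the `H J` are so small that they do not cover `E`. What is left of `E` has
its `n_J`-th preimage inside `E \ A J`. -/
theorem exists_tendsto_measure_preimage_and_image [IsFiniteMeasure μ]
    (hφ : QuasiMeasurePreserving φ μ μ) (hs : PreimageSmall μ φ) {F : Set X}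
    (hF : MeasurableSet F) (hF0 : 0 < μ F) {ψ : ℕ → ℕ} (hψ : StrictMono ψ)
    (hlim : Tendsto (fun k => μ (φ^[ψ k] '' F)) atTop (𝓝 0)) :
    ∃ G, MeasurableSet G ∧ 0 < μ G ∧
      (∃ θ : ℕ → ℕ, StrictMono θ ∧ Tendsto (fun k => μ (φ^[θ k] ⁻¹' G)) atTop (𝓝 0)) ∧
      ∃ θ : ℕ → ℕ, StrictMono θ ∧ Tendsto (fun k => μ (φ^[θ k] '' G)) atTop (𝓝 0) := by
  set B : ℕ → Set X := fun j => φ^[j] ⁻¹' F with hB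
  have hBm : ∀ j, MeasurableSet (B j) := fun j => hφ.measurable.iterate j hF
  set A : ℕ → Set X := accumulate B with hA
  set E : Set X := ⋃ j, B j with hE
  have hEm : MeasurableSet E := MeasurableSet.iUnion hBm
  have hE0 : 0 < μ E := hF0.trans_le (measure_mono (subset_iUnion B 0))
  have hAlim : ∀ J, Tendsto (fun k => μ (φ^[ψ k] '' A J)) atTop (𝓝 0) := by
    intro J
    have hsum : Tendsto (fun k => ∑ j ∈ Finset.Iic J,
        μ (φ^[j] ⁻¹' toMeasurable μ (φ^[ψ k] '' F))) atTop (𝓝 (∑ j ∈ Finset.Iic J, 0)) := by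
      refine tendsto_finsetSum _ fun j _ => hs.iterate hφ.measurable j _
        (fun k => measurableSet_toMeasurable _ _) ?_
      simpa only [measure_toMeasurable] using hlim
    rw [Finset.sum_const_zero] at hsum
    refine tendsto_of_tendsto_of_tendsto_of_le_of_le tendsto_const_nhds hsum
      (fun _ => zero_le) fun k => ?_
    refine le_trans (measure_mono ?_) (measure_accumulate_le _ J)
    rintro _ ⟨x, hx, rfl⟩
    obtain ⟨j, hj, hxj⟩ := mem_accumulate.1 hx
    refine mem_accumulate.2 ⟨j, hj, subset_toMeasurable _ _ ⟨φ^[j] x, hxj, ?_⟩⟩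
    exact Function.Commute.iterate_iterate_self φ _ _ x
  obtain ⟨ε, hε0, hε⟩ := ENNReal.exists_pos_sum_of_countable hE0.ne' ℕ
  obtain ⟨θ, hθ, hθε⟩ := extraction_forall_of_eventually
    (P := fun J k => μ (φ^[ψ k] '' A J) < ε J) fun J =>
      (hAlim J).eventually (gt_mem_nhds (by exact_mod_cast hε0 J))
  set H : ℕ → Set X := fun J => toMeasurable μ (φ^[ψ (θ J)] '' A J) with hH
  set G : Set X := E \ ⋃ J, H J with hG
  have hGm : MeasurableSet G :=
    hEm.diff (MeasurableSet.iUnion fun J => measurableSet_toMeasurable _ _)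
  have hHE : μ (⋃ J, H J) < μ E := by
    refine ((measure_iUnion_le _).trans (ENNReal.tsum_le_tsum fun J => ?_)).trans_lt hε
    rw [hH]
    simpa only [measure_toMeasurable] using (hθε J).le
  have hG0 : 0 < μ G := (tsub_pos_of_lt hHE).trans_le le_measure_sdiff
  obtain ⟨J, hJ⟩ : ∃ J, 0 < μ (G ∩ A J) := by
    by_contra! hcon
    have h0 : μ (⋃ J, G ∩ A J) = 0 := measure_iUnion_null fun J => nonpos_iff_eq_zero.1 (hcon J)
    rw [← inter_iUnion, hA, iUnion_accumulate, inter_eq_left.2 sdiff_subset] at h0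
    exact hG0.ne' h0
  refine ⟨G ∩ A J, hGm.inter (measurableSet_accumulate hBm J), hJ, ⟨fun k => ψ (θ k),
    hψ.comp hθ, ?_⟩, ψ, hψ, ?_⟩
  · refine tendsto_of_tendsto_of_tendsto_of_le_of_le tendsto_const_nhds
      (tendsto_measure_iUnion_diff_accumulate hBm) (fun _ => zero_le)
      fun k => measure_mono ?_
    rintro x ⟨⟨hxE, hxH⟩, -⟩
    refine ⟨?_, fun hxA => hxH (mem_iUnion.2 ⟨k, subset_toMeasurable _ _ ⟨x, hxA, rfl⟩⟩)⟩
    obtain ⟨j, hj⟩ := mem_iUnion.1 hxE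
    refine mem_iUnion.2 ⟨j + ψ (θ k), ?_⟩
    simpa only [hB, mem_preimage, Function.iterate_add_apply] using hj
  · exact tendsto_of_tendsto_of_tendsto_of_le_of_le tendsto_const_nhds (hAlim J)
      (fun _ => zero_le) fun k => measure_mono (image_mono inter_subset_right)

theorem tendsto_measure_image_of_wandering [IsFiniteMeasure μ] (hinj : Function.Injective φ)
    (himg : ∀ F, MeasurableSet F → MeasurableSet (φ '' F)) {W : Set X} (hW : MeasurableSet W)
    (hwand : ∀ x ∈ W, ∀ n, 0 < n → φ^[n] x ∉ W) :
    Tendsto (fun n => μ (φ^[n] '' W)) atTop (𝓝 0) := by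
  have hm : ∀ n, MeasurableSet (φ^[n] '' W) := by
    intro n
    induction n with
    | zero => simpa using hW
    | succ n ih => rw [Function.iterate_succ', image_comp]; exact himg _ ih
  have hdisj : Pairwise (Function.onFun Disjoint fun n => φ^[n] '' W) := by
    refine (pairwise_disjoint_on _).2 fun m n hmn => ?_
    refine Set.disjoint_left.2 ?_
    rintro _ ⟨x, hx, rfl⟩ ⟨y, hy, hxy⟩
    obtain ⟨d, rfl⟩ := Nat.exists_eq_add_of_lt hmn
    rw [add_assoc, Function.iterate_add_apply] at hxy
    refine hwand y hy (d + 1) d.succ_pos ?_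
    rwa [hinj.iterate m hxy]
  refine ENNReal.tendsto_atTop_zero_of_tsum_ne_top ?_
  rw [← measure_iUnion hdisj hm]
  exact measure_ne_top _ _

/-- In a finite measure space and for injective `φ`, a set whose preimages are small along a
subsequence yields a set whose forward images are small along a subsequence.

If almost no point visits `F` infinitely often, the points of `F` that never return to `F` form a
wandering set of positive measure. Otherwise the invariant set `Y` of points visiting `F` infinitely
often is exhausted by the sets `A J = ⋃ j ≤ J, φ⁻ʲ F`, and removing from `Y` small preimages
`φ^{-n_J} (A J)` leaves a set whose `n_J`-th image misses `A J`. -/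
theorem exists_tendsto_measure_image [IsFiniteMeasure μ]
    (hφ : QuasiMeasurePreserving φ μ μ) (hs : PreimageSmall μ φ) (hinj : Function.Injective φ)
    (himg : ∀ F, MeasurableSet F → MeasurableSet (φ '' F)) {F : Set X}
    (hF : MeasurableSet F) (hF0 : 0 < μ F) {ψ : ℕ → ℕ} (hψ : StrictMono ψ)
    (hlim : Tendsto (fun k => μ (φ^[ψ k] ⁻¹' F)) atTop (𝓝 0)) :
    ∃ G, MeasurableSet G ∧ 0 < μ G ∧
      ∃ θ : ℕ → ℕ, StrictMono θ ∧ Tendsto (fun k => μ (φ^[θ k] '' G)) atTop (𝓝 0) := by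
  set B : ℕ → Set X := fun j => φ^[j] ⁻¹' F with hB
  have hBm : ∀ j, MeasurableSet (B j) := fun j => hφ.measurable.iterate j hF
  set Y : Set X := limsup B atTop with hY
  have hYm : MeasurableSet Y := MeasurableSet.measurableSet_limsup hBm
  have hmemY : ∀ x, x ∈ Y ↔ ∃ᶠ n in atTop, φ^[n] x ∈ F := fun x => mem_limsup_iff_frequently_mem
  rcases (zero_le : 0 ≤ μ Y).eq_or_lt with hY0 | hY0
  · set W : Set X := F \ ⋃ n, B (n + 1) with hW
    have hWm : MeasurableSet W := hF.diff (MeasurableSet.iUnion fun n => hBm _)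
    refine ⟨W, hWm, ?_, id, strictMono_id,
      tendsto_measure_image_of_wandering hinj himg hWm ?_⟩
    · refine pos_iff_ne_zero.2 fun hW0 => hF0.ne' ?_
      have hcov : F ⊆ Y ∪ ⋃ n, φ^[n] ⁻¹' W := by
        intro x hx
        by_cases hxY : x ∈ Y
        · exact Or.inl hxY
        refine Or.inr ?_
        rw [hmemY, not_frequently, eventually_atTop] at hxY
        obtain ⟨N, hN⟩ := hxY
        -- the last visit of `x` to `F`
        classical
        set m := Nat.findGreatest (fun n => φ^[n] x ∈ F) N with hm
        have hmF : φ^[m] x ∈ F := Nat.findGreatest_spec (P := fun n => φ^[n] x ∈ F)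
          (Nat.zero_le N) (by simpa using hx)
        refine mem_iUnion.2 ⟨m, hmF, fun hU => ?_⟩
        obtain ⟨n, hn⟩ := mem_iUnion.1 hU
        have hn' : φ^[n + 1 + m] x ∈ F := by
          simpa only [hB, mem_preimage, Function.iterate_add_apply] using hn
        have hlt : n + 1 + m < N := by
          by_contra! h
          exact hN _ h hn'
        exact Nat.findGreatest_is_greatest (P := fun n => φ^[n] x ∈ F) (n := N)
          (k := n + 1 + m) (by omega) hlt.le hn'
      exact measure_mono_null hcov (measure_union_null hY0.symm
        (measure_iUnion_null fun n => (hφ.iterate n).preimage_null hW0))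
    · rintro x ⟨-, hx⟩ n hn ⟨hxF, -⟩
      obtain ⟨n, rfl⟩ := Nat.exists_eq_add_one.2 hn
      exact hx (mem_iUnion.2 ⟨n, hxF⟩)
  · have hAlim : ∀ J, Tendsto (fun k => μ (φ^[ψ k] ⁻¹' accumulate B J)) atTop (𝓝 0) := by
      intro J
      have hsum : Tendsto (fun k => ∑ j ∈ Finset.Iic J, μ (φ^[j] ⁻¹' (φ^[ψ k] ⁻¹' F))) atTop
          (𝓝 (∑ j ∈ Finset.Iic J, 0)) :=
        tendsto_finsetSum _ fun j _ => hs.iterate hφ.measurable j _ (fun k => hBm _) hlim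
      rw [Finset.sum_const_zero] at hsum
      refine tendsto_of_tendsto_of_tendsto_of_le_of_le tendsto_const_nhds hsum
        (fun _ => zero_le) fun k => ?_
      refine le_trans (measure_mono ?_) (measure_accumulate_le _ J)
      intro x hx
      obtain ⟨j, hj, hxj⟩ := mem_accumulate.1 hx
      refine mem_accumulate.2 ⟨j, hj, ?_⟩
      simp only [hB, mem_preimage] at hxj ⊢
      rwa [Function.Commute.iterate_iterate_self φ]
    obtain ⟨ε, hε0, hε⟩ := ENNReal.exists_pos_sum_of_countable hY0.ne' ℕ
    obtain ⟨θ, hθ, hθε⟩ := extraction_forall_of_eventually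
      (P := fun J k => μ (φ^[ψ k] ⁻¹' accumulate B J) < ε J) fun J =>
        (hAlim J).eventually (gt_mem_nhds (by exact_mod_cast hε0 J))
    have hHm : MeasurableSet (⋃ J, φ^[ψ (θ J)] ⁻¹' accumulate B J) :=
      MeasurableSet.iUnion fun J => hφ.measurable.iterate _ (measurableSet_accumulate hBm J)
    refine ⟨Y \ ⋃ J, φ^[ψ (θ J)] ⁻¹' accumulate B J, hYm.diff hHm, ?_, fun J => ψ (θ J),
      hψ.comp hθ, ?_⟩
    · refine (tsub_pos_of_lt ?_).trans_le le_measure_sdiff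
      exact ((measure_iUnion_le _).trans
        (ENNReal.tsum_le_tsum fun J => (hθε J).le)).trans_lt hε
    · refine tendsto_of_tendsto_of_tendsto_of_le_of_le tendsto_const_nhds
        (tendsto_measure_iUnion_diff_accumulate hBm) (fun _ => zero_le)
        fun k => measure_mono ?_
      rintro _ ⟨x, ⟨hxY, hxH⟩, rfl⟩
      refine ⟨?_, fun hxA => hxH (mem_iUnion.2 ⟨k, hxA⟩)⟩
      obtain ⟨n, hn, hnF⟩ := frequently_atTop.1 ((hmemY x).1 hxY) (ψ (θ k))
      obtain ⟨d, rfl⟩ := Nat.exists_eq_add_of_le' hn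
      refine mem_iUnion.2 ⟨d, ?_⟩
      simpa only [hB, mem_preimage, Function.iterate_add_apply] using hnF

/-- For injective `φ`, a set whose preimages are small eventually and whose forward images are
small along a subsequence yields a set `G` whose preimages are small along one subsequence but
not along another: `G` is a union of sparsely chosen forward images of the given set. -/
theorem exists_measure_preimage_oscillating
    (hφ : QuasiMeasurePreserving φ μ μ) (hs : PreimageSmall μ φ) (hinj : Function.Injective φ)
    (himg : ∀ F, MeasurableSet F → MeasurableSet (φ '' F)) {F : Set X}
    (hF : MeasurableSet F) (hF0 : 0 < μ F)
    (hpre : Tendsto (fun n => μ (φ^[n] ⁻¹' F)) atTop (𝓝 0))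
    {ψ : ℕ → ℕ} (hψ : StrictMono ψ)
    (hlim : Tendsto (fun k => μ (φ^[ψ k] '' F)) atTop (𝓝 0)) :
    ∃ G, MeasurableSet G ∧ 0 < μ G ∧ μ G < ∞ ∧
      (∃ θ : ℕ → ℕ, StrictMono θ ∧ Tendsto (fun k => μ (φ^[θ k] ⁻¹' G)) atTop (𝓝 0)) ∧
      ¬ Tendsto (fun n => μ (φ^[n] ⁻¹' G)) atTop (𝓝 0) := by
  have hm : ∀ n, MeasurableSet (φ^[n] '' F) := by
    intro n
    induction n with
    | zero => simpa using hF
    | succ n ih => rw [Function.iterate_succ', image_comp]; exact himg _ ih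
  have hrow : ∀ k, Tendsto (fun m => μ (φ^[m] ⁻¹' (φ^[ψ k] '' F))) atTop (𝓝 0) := by
    intro k
    -- by injectivity, `φ⁻⁽ⁿ⁺ᵐ⁾ (φⁿ F) = φ⁻ᵐ F`
    refine (tendsto_add_atTop_iff_nat (ψ k)).1 (hpre.congr fun m => ?_)
    rw [add_comm, Function.iterate_add, preimage_comp, preimage_image_eq _ (hinj.iterate _)]
  obtain ⟨κ, τ, hκ, hτ, hb, hb0⟩ := exists_strictMono_le_two_inv_pow_mul hrow
    fun m => hs.iterate hφ.measurable m _ (fun k => hm _) hlim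
  have hgeom : ∑' i : ℕ, (2⁻¹ : ℝ≥0∞) ^ i = 2 := by
    rw [ENNReal.tsum_geometric, ENNReal.one_sub_inv_two, inv_inv]
  set G : Set X := ⋃ i, φ^[ψ (κ i)] '' F with hG
  have hsub : ∀ i, F ⊆ φ^[ψ (κ i)] ⁻¹' G := fun i x hx => mem_iUnion.2 ⟨i, x, hx, rfl⟩
  refine ⟨G, MeasurableSet.iUnion fun i => hm _, ?_, ?_, ⟨τ, hτ, ?_⟩, fun hcon => ?_⟩
  · refine pos_iff_ne_zero.2 fun h0 => hF0.ne' ?_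
    exact measure_mono_null (hsub 0) ((hφ.iterate _).preimage_null h0)
  · calc μ G ≤ ∑' i, μ (φ^[ψ (κ i)] '' F) := measure_iUnion_le _
      _ ≤ ∑' i : ℕ, 2⁻¹ ^ i := ENNReal.tsum_le_tsum fun i => by simpa using hb0 i
      _ < ∞ := by rw [hgeom]; exact ENNReal.ofNat_lt_top
  · have hz : Tendsto (fun k : ℕ => 2 * (2⁻¹ : ℝ≥0∞) ^ k) atTop (𝓝 0) := by
      have := ENNReal.Tendsto.const_mul (a := 2)
        (ENNReal.tendsto_pow_atTop_nhds_zero_of_lt_one (r := 2⁻¹) (by simp))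
        (Or.inr ENNReal.ofNat_ne_top)
      rwa [mul_zero] at this
    refine tendsto_of_tendsto_of_tendsto_of_le_of_le tendsto_const_nhds hz
      (fun _ => zero_le) fun k => ?_
    calc μ (φ^[τ k] ⁻¹' G) ≤ ∑' i, μ (φ^[τ k] ⁻¹' (φ^[ψ (κ i)] '' F)) := by
          rw [hG, preimage_iUnion]; exact measure_iUnion_le _
      _ ≤ ∑' i : ℕ, 2⁻¹ ^ i * 2⁻¹ ^ k := ENNReal.tsum_le_tsum fun i => hb i k
      _ = 2 * 2⁻¹ ^ k := by rw [ENNReal.tsum_mul_right, hgeom]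
  · have h := hcon.comp (hψ.comp hκ).tendsto_atTop
    exact hF0.not_ge (ge_of_tendsto' h fun i => measure_mono (hsub i))

end Dynamics

/-! ### The generalized inverse of a Young function -/

namespace YoungFunction

variable {Φ : YoungFunction}

theorem inv_le {y : ℝ≥0∞} {x : ℝ} (hx : 0 ≤ x) (h : y < Φ x) : Φ.inv y ≤ ENNReal.ofReal x :=
  iInf_le_of_le x (iInf_le_of_le hx (iInf_le _ h))

theorem le_inv {y : ℝ≥0∞} {x : ℝ} (h : Φ x ≤ y) : ENNReal.ofReal x ≤ Φ.inv y := by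
  refine le_iInf fun z => le_iInf fun hz => le_iInf fun hy => ENNReal.ofReal_le_ofReal ?_
  by_contra! hzx
  refine (h.trans_lt hy).not_ge (Φ.mono_abs ?_)
  rw [abs_of_nonneg hz, abs_of_nonneg (hz.trans hzx.le)]
  exact hzx.le

theorem inv_lt_top {y : ℝ≥0∞} (hy : y < ∞) : Φ.inv y < ∞ := by
  obtain ⟨x, hx, hx0⟩ := ((Φ.tendsto'.eventually (lt_mem_nhds hy)).and
    (eventually_ge_atTop (0 : ℝ))).exists
  exact (inv_le hx0 hx).trans_lt ENNReal.ofReal_lt_top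

theorem inv_top : Φ.inv ∞ = ∞ := by
  simp [inv]

theorem DeltaTwo.lt_top (h : Φ.DeltaTwo) (x : ℝ) : Φ x < ∞ := by
  obtain ⟨K, x₀, -, hx₀, h⟩ := h
  refine (Φ.mono_abs ?_).trans_lt (h (max |x| x₀) (le_max_right _ _)).2
  exact (le_max_left _ _).trans (le_abs_self _)

/-- For a finite Young function, `Φ⁻¹(1 / m)` is large exactly when `m` is small. -/
theorem tendsto_inv_one_div_iff (hΦ : ∀ x, Φ x < ∞) {ι : Type*} {l : Filter ι} {m : ι → ℝ≥0∞} :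
    Tendsto (fun i => Φ.inv (1 / m i)) l (𝓝 ∞) ↔ Tendsto m l (𝓝 0) := by
  simp only [one_div]
  rw [ENNReal.tendsto_nhds_top_iff_nat, ← tendsto_inv_iff, ENNReal.inv_zero]
  constructor
  · intro h
    refine ENNReal.tendsto_nhds_top fun n => ?_
    obtain ⟨x, hx, hx0⟩ := ((Φ.tendsto'.eventually (lt_mem_nhds (ENNReal.natCast_lt_top n))).and
      (eventually_ge_atTop (0 : ℝ))).exists
    obtain ⟨N, hN⟩ := exists_nat_ge x
    filter_upwards [h N] with i hi
    refine hx.trans_le ?_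
    by_contra! hlt
    refine ((inv_le hx0 hlt).trans ?_).not_gt hi
    rw [← ENNReal.ofReal_natCast]
    exact ENNReal.ofReal_le_ofReal hN
  · intro h n
    filter_upwards [h.eventually (lt_mem_nhds (hΦ (n + 1)))] with i hi
    refine lt_of_lt_of_le ?_ (le_inv hi.le)
    rw [← ENNReal.ofReal_natCast]
    exact (ENNReal.ofReal_lt_ofReal_iff (by positivity)).2 (lt_add_one _)

end YoungFunction

/-! ### Characteristic functions and the composition operator -/

section Orlicz

variable {X : Type*} [MeasurableSpace X] {Φ : YoungFunction} {μ : Measure X} {φ : X → X}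

theorem lintegral_chi {F : Set X} (hF : MeasurableSet F) (c : ℝ) :
    ∫⁻ x, Φ (c * chi μ hF x) ∂μ = Φ c * μ F := by
  rw [← lintegral_indicator_const hF]
  refine lintegral_congr_ae ?_
  filter_upwards [AEEqFun.coeFn_mk (F.indicator fun _ => (1 : ℝ))
    (stronglyMeasurable_const.indicator hF).aestronglyMeasurable] with x hx
  rw [chi, hx]
  by_cases h : x ∈ F <;> simp [h, Φ.zero']

theorem chi_mem_orliczSpace {F : Set X} (hF : MeasurableSet F) (h : μ F < ∞) :
    chi μ hF ∈ OrliczSpace Φ μ := by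
  obtain ⟨x, hx, hΦ⟩ := Φ.exists_lt_top'
  exact ⟨x, hx, by rw [lintegral_chi]; exact ENNReal.mul_lt_top hΦ h⟩

theorem gaugeNorm_chi {F : Set X} (hF : MeasurableSet F) :
    gaugeNorm Φ (chi μ hF) = (Φ.inv (1 / μ F))⁻¹ := by
  have hmod : ∀ k : ℝ, ∫⁻ x, Φ (chi μ hF x / k) ∂μ ≤ 1 ↔ Φ k⁻¹ ≤ 1 / μ F := by
    intro k
    simp only [div_eq_inv_mul]
    rw [lintegral_chi]
    rcases eq_or_ne (μ F) 0 with h0 | h0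
    · simp [h0]
    rcases eq_or_ne (μ F) ∞ with h1 | h1
    · by_cases h : Φ k⁻¹ = 0 <;> simp [h, h1, ENNReal.mul_top]
    · rw [← one_div, ENNReal.le_div_iff_mul_le (Or.inl h0) (Or.inl h1)]
  refine le_antisymm (le_of_not_gt fun hlt => ?_) ?_
  · obtain ⟨r, hr1, hr2⟩ := ENNReal.lt_iff_exists_nnreal_btwn.1 hlt
    have hr0 : (0 : ℝ) < r := by exact_mod_cast pos_of_gt hr1
    rw [← ENNReal.ofReal_coe_nnreal] at hr1 hr2
    refine hr2.not_ge (gaugeNorm_le hr0 ((hmod r).2 ?_))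
    by_contra! h
    have := YoungFunction.inv_le (inv_nonneg.2 hr0.le) h
    rw [ENNReal.ofReal_inv_of_pos hr0, ENNReal.le_inv_iff_le_inv] at this
    exact hr1.not_ge this
  · refine le_iInf fun k => le_iInf fun hk => le_iInf fun h => ?_
    rw [ENNReal.inv_le_iff_inv_le, ← ENNReal.ofReal_inv_of_pos hk]
    exact YoungFunction.le_inv ((hmod k).1 h)

theorem gaugeNorm_mono {f g : X →ₘ[μ] ℝ} (h : ∀ᵐ x ∂μ, |f x| ≤ |g x|) :
    gaugeNorm Φ f ≤ gaugeNorm Φ g := by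
  refine le_iInf fun k => le_iInf fun hk => le_iInf fun hg =>
    gaugeNorm_le hk ((lintegral_mono_ae ?_).trans hg)
  filter_upwards [h] with x hx
  refine Φ.mono_abs ?_
  rw [abs_div, abs_div]
  gcongr

theorem coeFn_iterate_compOp (hφ : QuasiMeasurePreserving φ μ μ) (h : CompMapsOrlicz Φ hφ) (n : ℕ)
    (f : OrliczSpace Φ μ) :
    (((compOp Φ hφ h)^[n] f : X →ₘ[μ] ℝ) : X → ℝ) =ᵐ[μ] (f : X →ₘ[μ] ℝ) ∘ φ^[n] := by
  induction n with
  | zero => rfl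
  | succ n ih =>
    rw [Function.iterate_succ_apply', Function.iterate_succ]
    exact (AEEqFun.coeFn_compQuasiMeasurePreserving _ hφ).trans (hφ.ae_eq_comp ih)

theorem iterate_compOp_chi (hφ : QuasiMeasurePreserving φ μ μ) (h : CompMapsOrlicz Φ hφ) (n : ℕ)
    {F : Set X} (hF : MeasurableSet F) (hmem : chi μ hF ∈ OrliczSpace Φ μ) :
    ((compOp Φ hφ h)^[n] ⟨chi μ hF, hmem⟩ : X →ₘ[μ] ℝ) = chi μ (hφ.measurable.iterate n hF) := by
  refine AEEqFun.ext ((coeFn_iterate_compOp hφ h n _).trans ?_)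
  refine ((hφ.iterate n).ae_eq_comp (AEEqFun.coeFn_mk _ _)).trans ?_
  exact (AEEqFun.coeFn_mk _ _).symm

theorem gaugeNorm_iterate_compOp_chi (hφ : QuasiMeasurePreserving φ μ μ)
    (h : CompMapsOrlicz Φ hφ) (n : ℕ) {F : Set X} (hF : MeasurableSet F)
    (hmem : chi μ hF ∈ OrliczSpace Φ μ) :
    gaugeNorm Φ ((compOp Φ hφ h)^[n] ⟨chi μ hF, hmem⟩ : X →ₘ[μ] ℝ) =
      (youngInvPreimage Φ μ φ F n)⁻¹ := by
  rw [iterate_compOp_chi, gaugeNorm_chi, youngInvPreimage]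

/-- If `Φ` is finite and `C_φ` is continuous, then `φ` pulls small sets back to small sets, since
`N_Φ(χ_H)` is small exactly when `μ H` is. -/
theorem preimageSmall_of_continuous_compOp (hφ : QuasiMeasurePreserving φ μ μ)
    (h : CompMapsOrlicz Φ hφ) (hcont : Continuous (compOp Φ hφ h)) (hΦ : ∀ x, Φ x < ∞) :
    PreimageSmall μ φ := by
  intro H hH hlim
  set T : OrliczSpace Φ μ →L[ℝ] OrliczSpace Φ μ := ⟨compOp Φ hφ h, hcont⟩ with hT
  rw [← YoungFunction.tendsto_inv_one_div_iff hΦ, ← tendsto_inv_iff, ENNReal.inv_top]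
    at hlim ⊢
  have hz : Tendsto (fun k => ‖T‖ₑ * (Φ.inv (1 / μ (H k)))⁻¹) atTop (𝓝 0) := by
    have := ENNReal.Tendsto.const_mul hlim (Or.inr (enorm_ne_top (x := T)))
    rwa [mul_zero] at this
  refine tendsto_of_tendsto_of_tendsto_of_le_of_le' tendsto_const_nhds hz
    (Eventually.of_forall fun _ => zero_le) ?_
  -- eventually `Φ⁻¹ (1 / μ (H k)) > Φ⁻¹ 0`, which excludes `μ (H k) = ∞`
  have hfin := hlim.eventually (gt_mem_nhds
    (ENNReal.inv_pos.2 (YoungFunction.inv_lt_top (Φ := Φ) ENNReal.zero_lt_top).ne))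
  filter_upwards [hfin] with k hk
  have hHk : μ (H k) < ∞ := by
    refine lt_top_iff_ne_top.2 fun htop => ?_
    simp [htop] at hk
  have := T.le_opENorm ⟨chi μ (hH k), chi_mem_orliczSpace (hH k) hHk⟩
  rw [OrliczSpace.enorm_eq, OrliczSpace.enorm_eq, gaugeNorm_chi] at this
  refine le_trans (le_of_eq ?_) this
  exact (gaugeNorm_iterate_compOp_chi hφ h 1 (hH k) _).symm

/-! ### Linear dynamics -/

theorem liYorkeChaotic_of_isSemiIrregular {E : Type*} [NormedAddCommGroup E] [NormedSpace ℝ E]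
    (T : E →ₗ[ℝ] E) {x : E} (hx : IsSemiIrregular T x) : LiYorkeChaotic T := by
  have hx0 : x ≠ 0 := by
    rintro rfl
    have h := hx.2
    simp at h
  have hinj : Function.Injective fun t : ℝ => t • x := smul_left_injective ℝ hx0
  refine ⟨range fun t : ℝ => t • x, fun hc => ?_, ?_⟩
  · refine Cardinal.not_countable_real ?_
    rw [← image_univ] at hc
    exact (countable_of_injective_of_countable_image hinj.injOn hc)
  · rintro _ ⟨s, rfl⟩ _ ⟨t, rfl⟩ hst
    have hne : s - t ≠ 0 := sub_ne_zero.2 fun h => hst (by rw [h])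
    have hd : (fun n => edist (T^[n] (s • x)) (T^[n] (t • x))) =
        fun n => ‖s - t‖ₑ * ‖T^[n] x‖ₑ := by
      funext n
      rw [edist_eq_enorm_sub, ← Module.End.coe_pow, ← map_sub, ← sub_smul, map_smul, enorm_smul]
    have h0 : ‖s - t‖ₑ ≠ 0 := enorm_ne_zero.2 hne
    have h1 : ‖s - t‖ₑ ≠ ∞ := enorm_ne_top
    simp only [IsLiYorkePair]
    rw [hd, ENNReal.liminf_const_mul_of_ne_top h1, ENNReal.limsup_const_mul_of_ne_top h1, hx.1,
      mul_zero]
    exact ⟨rfl, ENNReal.mul_pos h0 hx.2.ne'⟩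

end Orlicz

/-! ### Implications between the conditions -/

section Conditions

variable {X : Type*} [MeasurableSpace X] {Φ : YoungFunction} {μ : Measure X} {φ : X → X}

theorem limsup_youngInvPreimage_eq_top_iff (hΦ : ∀ x, Φ x < ∞) {F : Set X} :
    limsup (youngInvPreimage Φ μ φ F) atTop = ∞ ↔
      ∃ ψ : ℕ → ℕ, StrictMono ψ ∧ Tendsto (fun k => μ (φ^[ψ k] ⁻¹' F)) atTop (𝓝 0) := by
  rw [ENNReal.limsup_eq_top_iff_exists_tendsto]
  exact exists_congr fun ψ => and_congr_right fun _ => YoungFunction.tendsto_inv_one_div_iff hΦ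

theorem limsup_youngInvImage_eq_top_iff (hΦ : ∀ x, Φ x < ∞) {F : Set X} :
    limsup (youngInvImage Φ μ φ F) atTop = ∞ ↔
      ∃ ψ : ℕ → ℕ, StrictMono ψ ∧ Tendsto (fun k => μ (φ^[ψ k] '' F)) atTop (𝓝 0) := by
  rw [ENNReal.limsup_eq_top_iff_exists_tendsto]
  exact exists_congr fun ψ => and_congr_right fun _ => YoungFunction.tendsto_inv_one_div_iff hΦ

theorem liminf_youngInvPreimage_eq_top_iff (hΦ : ∀ x, Φ x < ∞) {F : Set X} :
    liminf (youngInvPreimage Φ μ φ F) atTop = ∞ ↔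
      Tendsto (fun n => μ (φ^[n] ⁻¹' F)) atTop (𝓝 0) := by
  rw [← YoungFunction.tendsto_inv_one_div_iff hΦ]
  refine ⟨fun h => tendsto_of_le_liminf_of_limsup_le h.ge le_top, fun h => h.liminf_eq⟩

theorem youngInvPreimage_eq_top_of_measure_zero (hφ : QuasiMeasurePreserving φ μ μ) {F : Set X}
    (hF : μ F = 0) (n : ℕ) :
    youngInvPreimage Φ μ φ F n = ∞ := by
  rw [youngInvPreimage, (hφ.iterate n).preimage_null hF, ENNReal.div_zero one_ne_zero,
    YoungFunction.inv_top]

variable (hφ : QuasiMeasurePreserving φ μ μ) (hmaps : CompMapsOrlicz Φ hφ)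

theorem isSemiIrregular_chi_iff {F : Set X} (hF : MeasurableSet F)
    (hmem : chi μ hF ∈ OrliczSpace Φ μ) :
    IsSemiIrregular (compOp Φ hφ hmaps) ⟨chi μ hF, hmem⟩ ↔
      limsup (youngInvPreimage Φ μ φ F) atTop = ∞ ∧
        liminf (youngInvPreimage Φ μ φ F) atTop < ∞ := by
  have h : (fun n => ‖(compOp Φ hφ hmaps)^[n] ⟨chi μ hF, hmem⟩‖ₑ) =
      fun n => (youngInvPreimage Φ μ φ F n)⁻¹ := by
    funext n
    rw [OrliczSpace.enorm_eq, gaugeNorm_iterate_compOp_chi]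
  rw [IsSemiIrregular, h, ← ENNReal.inv_limsup, ← ENNReal.inv_liminf, ENNReal.inv_eq_zero,
    ENNReal.inv_pos, lt_top_iff_ne_top]

/-- When `Φ` vanishes near `0`, a characteristic function `χ_F` with `μ F = ∞` may lie in
`L^Φ(μ)`. If it is semi-irregular, then some preimage of `F` has finite positive measure and the
same asymptotics. -/
theorem backwardOscillating_iff_hasSemiIrregularChi :
    BackwardOscillating Φ μ φ ↔ HasSemiIrregularChi Φ hφ hmaps := by
  constructor
  · rintro ⟨F, hF, -, hFt, hinf, hsup⟩
    exact ⟨F, hF, chi_mem_orliczSpace hF hFt,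
      (isSemiIrregular_chi_iff hφ hmaps hF _).2 ⟨hsup, hinf⟩⟩
  · rintro ⟨F, hF, hmem, h⟩
    obtain ⟨hsup, hinf⟩ := (isSemiIrregular_chi_iff hφ hmaps hF hmem).1 h
    obtain ⟨m, hm⟩ : ∃ m, Φ.inv 0 < youngInvPreimage Φ μ φ F m := by
      refine (frequently_lt_of_lt_limsup (f := atTop) (by isBoundedDefault) ?_).exists
      rw [hsup]
      exact YoungFunction.inv_lt_top ENNReal.zero_lt_top
    have hshift : youngInvPreimage Φ μ φ (φ^[m] ⁻¹' F) =
        fun n => youngInvPreimage Φ μ φ F (n + m) := by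
      funext n
      rw [youngInvPreimage, youngInvPreimage, ← preimage_comp, ← Function.iterate_add, add_comm]
    have hinf' : liminf (youngInvPreimage Φ μ φ (φ^[m] ⁻¹' F)) atTop < ∞ := by
      rwa [hshift, liminf_nat_add]
    refine ⟨φ^[m] ⁻¹' F, hφ.measurable.iterate m hF, pos_iff_ne_zero.2 fun h0 => ?_,
      lt_top_iff_ne_top.2 fun htop => ?_, hinf', ?_⟩
    · refine hinf'.ne ?_
      simp only [funext (youngInvPreimage_eq_top_of_measure_zero (Φ := Φ) hφ h0), liminf_const]
    · rw [youngInvPreimage, htop, ENNReal.div_top] at hm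
      exact hm.ne rfl
    · rwa [hshift, limsup_nat_add]

theorem hasVanishingOrbit_of_liYorkeChaotic (h : LiYorkeChaotic (compOp Φ hφ hmaps)) :
    HasVanishingOrbit Φ hφ hmaps := by
  obtain ⟨S, hS, hpair⟩ := h
  obtain ⟨x, hx, y, hy, hxy⟩ : S.Nontrivial := by
    by_contra hcon
    exact hS (not_nontrivial_iff.1 hcon).countable
  refine ⟨x - y, sub_ne_zero.2 hxy, ?_⟩
  rw [← (hpair x hx y hy hxy).1]
  congr 1
  funext n
  rw [edist_eq_enorm_sub, ← OrliczSpace.enorm_eq, ← Module.End.coe_pow, map_sub]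

/-- A nonzero `f` dominates a multiple of a characteristic function of a set of finite positive
measure, whose orbit therefore vanishes along the same subsequence. -/
theorem hasVanishingOrbit_iff_backwardVanishing [SigmaFinite μ] :
    HasVanishingOrbit Φ hφ hmaps ↔ BackwardVanishing Φ μ φ := by
  constructor
  · rintro ⟨f, hf, hlim⟩
    have hfm : Measurable (f : X →ₘ[μ] ℝ) := (AEEqFun.stronglyMeasurable _).measurable
    obtain ⟨n, hn⟩ : ∃ n : ℕ, 0 < μ {x | 1 / ((n : ℝ) + 1) ≤ |(f : X →ₘ[μ] ℝ) x|} := by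
      by_contra! hcon
      refine hf (Subtype.ext (AEEqFun.ext (EventuallyEq.trans ?_ AEEqFun.coeFn_zero.symm)))
      have h : ∀ᵐ x ∂μ, ∀ n : ℕ, ¬ (1 / ((n : ℝ) + 1) ≤ |(f : X →ₘ[μ] ℝ) x|) := by
        rw [ae_all_iff]
        intro n
        rw [ae_iff]
        simpa using hcon n
      filter_upwards [h] with x hx
      by_contra hne
      obtain ⟨n, hn⟩ := exists_nat_one_div_lt (abs_pos.2 hne)
      exact hx n hn.le
    set c : ℝ := (n : ℝ) + 1 with hc
    have hc0 : 0 < c := by positivity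
    obtain ⟨F, hF, hFsub, hF0, hFt⟩ :=
      exists_subset_measure_lt_top (measurableSet_le measurable_const hfm.abs) hn
    have hmem := chi_mem_orliczSpace (Φ := Φ) hF hFt
    have hle : ∀ m, (youngInvPreimage Φ μ φ F m)⁻¹ ≤ ENNReal.ofReal |c| *
        gaugeNorm Φ ((compOp Φ hφ hmaps)^[m] f : X →ₘ[μ] ℝ) := by
      intro m
      rw [← gaugeNorm_iterate_compOp_chi hφ hmaps m hF hmem, ← gaugeNorm_smul]
      refine gaugeNorm_mono ?_
      filter_upwards [coeFn_iterate_compOp hφ hmaps m ⟨chi μ hF, hmem⟩,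
        coeFn_iterate_compOp hφ hmaps m f,
        AEEqFun.coeFn_smul c ((compOp Φ hφ hmaps)^[m] f : X →ₘ[μ] ℝ),
        (hφ.iterate m).ae_eq_comp (AEEqFun.coeFn_mk (F.indicator fun _ => (1 : ℝ))
          (stronglyMeasurable_const.indicator hF).aestronglyMeasurable)] with x h1 h2 h3 h4
      rw [h1, h3, Pi.smul_apply, h2]
      simp only [chi]
      rw [h4]
      simp only [Function.comp_apply, smul_eq_mul, abs_mul, abs_of_pos hc0]
      by_cases hx : φ^[m] x ∈ F
      · have : 1 / c ≤ |(f : X →ₘ[μ] ℝ) (φ^[m] x)| := hFsub hx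
        rw [div_le_iff₀' hc0] at this
        simpa [hx] using this
      · simp only [hx, not_false_eq_true, indicator_of_notMem, abs_zero]
        positivity
    refine ⟨F, hF, hF0, hFt, ?_⟩
    rw [← ENNReal.inv_eq_zero, ENNReal.inv_limsup]
    refine le_antisymm ((liminf_le_liminf (Eventually.of_forall hle)).trans ?_) zero_le
    rw [ENNReal.liminf_const_mul_of_ne_top ENNReal.ofReal_ne_top, hlim, mul_zero]
  · rintro ⟨F, hF, hF0, hFt, hsup⟩
    refine ⟨⟨chi μ hF, chi_mem_orliczSpace hF hFt⟩, fun h0 => ?_, ?_⟩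
    · have h1 : gaugeNorm Φ (chi μ hF) = 0 := by
        rw [show chi μ hF = 0 from Subtype.ext_iff.1 h0, gaugeNorm_zero]
      rw [gaugeNorm_chi, ENNReal.inv_eq_zero] at h1
      refine (YoungFunction.inv_lt_top (Φ := Φ) ?_).ne h1
      rw [one_div]
      exact ENNReal.inv_lt_top.2 hF0
    · simp only [gaugeNorm_iterate_compOp_chi hφ hmaps _ hF]
      rw [← ENNReal.inv_limsup, hsup, ENNReal.inv_top]

theorem backwardOscillating_of_twoSidedVanishing
    (hcont : Continuous (compOp Φ hφ hmaps)) (hinj : Function.Injective φ)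
    (himg : ∀ F, MeasurableSet F → MeasurableSet (φ '' F)) (hΦ : ∀ x, Φ x < ∞)
    (h : TwoSidedVanishing Φ μ φ) : BackwardOscillating Φ μ φ := by
  obtain ⟨F, hF, hF0, hFt, hpre, himage⟩ := h
  by_cases hlim : liminf (youngInvPreimage Φ μ φ F) atTop < ∞
  · exact ⟨F, hF, hF0, hFt, hlim, hpre⟩
  rw [not_lt_top_iff, liminf_youngInvPreimage_eq_top_iff hΦ] at hlim
  obtain ⟨ψ, hψ, hψlim⟩ := (limsup_youngInvImage_eq_top_iff hΦ).1 himage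
  obtain ⟨G, hG, hG0, hGt, hsup, hinf⟩ := exists_measure_preimage_oscillating hφ
    (preimageSmall_of_continuous_compOp hφ hmaps hcont hΦ) hinj himg hF hF0 hlim hψ hψlim
  exact ⟨G, hG, hG0, hGt,
    lt_top_iff_ne_top.2 (mt (liminf_youngInvPreimage_eq_top_iff hΦ).1 hinf),
    (limsup_youngInvPreimage_eq_top_iff hΦ).2 hsup⟩

theorem twoSidedVanishing_of_forwardVanishing [IsFiniteMeasure μ]
    (hcont : Continuous (compOp Φ hφ hmaps)) (hΦ : ∀ x, Φ x < ∞)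
    (h : ForwardVanishing Φ μ φ) : TwoSidedVanishing Φ μ φ := by
  obtain ⟨F, hF, hF0, -, himage⟩ := h
  obtain ⟨ψ, hψ, hψlim⟩ := (limsup_youngInvImage_eq_top_iff hΦ).1 himage
  obtain ⟨G, hG, hG0, hpre, himage'⟩ := exists_tendsto_measure_preimage_and_image hφ
    (preimageSmall_of_continuous_compOp hφ hmaps hcont hΦ) hF hF0 hψ hψlim
  exact ⟨G, hG, hG0, measure_lt_top _ _, (limsup_youngInvPreimage_eq_top_iff hΦ).2 hpre,
    (limsup_youngInvImage_eq_top_iff hΦ).2 himage'⟩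

theorem forwardVanishing_of_backwardVanishing
    [IsFiniteMeasure μ] (hcont : Continuous (compOp Φ hφ hmaps)) (hinj : Function.Injective φ)
    (himg : ∀ F, MeasurableSet F → MeasurableSet (φ '' F)) (hΦ : ∀ x, Φ x < ∞)
    (h : BackwardVanishing Φ μ φ) : ForwardVanishing Φ μ φ := by
  obtain ⟨F, hF, hF0, -, hpre⟩ := h
  obtain ⟨ψ, hψ, hψlim⟩ := (limsup_youngInvPreimage_eq_top_iff hΦ).1 hpre
  obtain ⟨G, hG, hG0, himage⟩ := exists_tendsto_measure_image hφ
    (preimageSmall_of_continuous_compOp hφ hmaps hcont hΦ) hinj himg hF hF0 hψ hψlim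
  exact ⟨G, hG, hG0, measure_lt_top _ _, (limsup_youngInvImage_eq_top_iff hΦ).2 himage⟩

end Conditions

theorem mainTheorem2 {X : Type*} [MeasurableSpace X] (μ : Measure X) [SigmaFinite μ]
    (Φ : YoungFunction) (φ : X → X) (hφ : QuasiMeasurePreserving φ μ μ)
    (hmaps : CompMapsOrlicz Φ hφ) (hcont : Continuous (compOp Φ hφ hmaps)) :
    (BackwardOscillating Φ μ φ ↔ HasSemiIrregularChi Φ hφ hmaps) ∧
    (HasSemiIrregularChi Φ hφ hmaps → LiYorkeChaotic (compOp Φ hφ hmaps)) ∧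
    (LiYorkeChaotic (compOp Φ hφ hmaps) → HasVanishingOrbit Φ hφ hmaps) ∧
    (HasVanishingOrbit Φ hφ hmaps ↔ BackwardVanishing Φ μ φ) ∧
    (TwoSidedVanishing Φ μ φ → BackwardVanishing Φ μ φ) ∧
    (TwoSidedVanishing Φ μ φ → ForwardVanishing Φ μ φ) ∧
    (Function.Injective φ → (∀ F, MeasurableSet F → MeasurableSet (φ '' F)) → Φ.DeltaTwo →
      TwoSidedVanishing Φ μ φ → BackwardOscillating Φ μ φ) ∧
    (Φ.DeltaTwo → μ univ < ∞ → ForwardVanishing Φ μ φ → TwoSidedVanishing Φ μ φ) ∧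
    (Function.Injective φ → (∀ F, MeasurableSet F → MeasurableSet (φ '' F)) → Φ.DeltaTwo →
      μ univ < ∞ →
      List.TFAE [LiYorkeChaotic (compOp Φ hφ hmaps), HasVanishingOrbit Φ hφ hmaps,
        BackwardVanishing Φ μ φ, ForwardVanishing Φ μ φ, TwoSidedVanishing Φ μ φ,
        BackwardOscillating Φ μ φ, HasSemiIrregularChi Φ hφ hmaps]) := by
  have h67 := backwardOscillating_iff_hasSemiIrregularChi hφ hmaps
  have h71 : HasSemiIrregularChi Φ hφ hmaps → LiYorkeChaotic (compOp Φ hφ hmaps) := by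
    rintro ⟨F, hF, hmem, h⟩
    exact liYorkeChaotic_of_isSemiIrregular (compOp Φ hφ hmaps) h
  have h12 := hasVanishingOrbit_of_liYorkeChaotic hφ hmaps
  have h23 := hasVanishingOrbit_iff_backwardVanishing hφ hmaps
  have h53 : TwoSidedVanishing Φ μ φ → BackwardVanishing Φ μ φ :=
    fun ⟨F, hF, hF0, hFt, h, _⟩ => ⟨F, hF, hF0, hFt, h⟩
  have h54 : TwoSidedVanishing Φ μ φ → ForwardVanishing Φ μ φ :=
    fun ⟨F, hF, hF0, hFt, _, h⟩ => ⟨F, hF, hF0, hFt, h⟩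
  refine ⟨h67, h71, h12, h23, h53, h54, fun hinj himg hΔ =>
    backwardOscillating_of_twoSidedVanishing hφ hmaps hcont hinj himg hΔ.lt_top,
    fun hΔ hfin => ?_, fun hinj himg hΔ hfin => ?_⟩
  · have : IsFiniteMeasure μ := ⟨hfin⟩
    exact twoSidedVanishing_of_forwardVanishing hφ hmaps hcont hΔ.lt_top
  · have : IsFiniteMeasure μ := ⟨hfin⟩
    have h56 := backwardOscillating_of_twoSidedVanishing hφ hmaps hcont hinj himg hΔ.lt_top
    have h45 := twoSidedVanishing_of_forwardVanishing hφ hmaps hcont hΔ.lt_top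
    have h34 := forwardVanishing_of_backwardVanishing hφ hmaps hcont hinj himg hΔ.lt_top
    tfae_have 1 → 2 := h12
    tfae_have 2 → 3 := h23.1
    tfae_have 3 → 4 := h34
    tfae_have 4 → 5 := h45
    tfae_have 5 → 6 := h56
    tfae_have 6 → 7 := h67.1
    tfae_have 7 → 1 := h71
    tfae_finish
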